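/- For integers $w\ge 1$ and $N\ge 2w$, let $\mathsf{ApxCount}_{N,w}$ be the promise problem of deciding, for a nonempty set $S\subseteq[N]=\{1,\dots,N\}$, whether $|S|\ge 2w$ (yes) or $|S|\le w$ (no), promised that one of these holds. Let $\mathsf{AND}_2\circ\mathsf{ApxCount}_{N,w}$ be the promise problem whose instances are pairs $(S_0,S_1)$ of sets, each satisfying the promise of $\mathsf{ApxCount}_{N,w}$; such a pair is a yes instance if both $S_0$ and $S_1$ are yes instances, and a no instance otherwise. The membership oracle of $S\subseteq[N]$ is the unitary $\mathcal{O}_S|i\rangle|b\rangle=(1-2b\,x_i)|i\rangle|b\rangle$ for $i\in[N]$, $b\in\{0,1\}$, where $x_i=1$ if $i\in S$ and $x_i=0$ otherwise. A quantum query algorithm $Q$ making $T$ queries to the membership oracles of a pair $(S_0,S_1)$ works on registers $|k\rangle|i\rangle|b\rangle|z\rangle$, where $k\in\{0,1\}$, $i\in[N]$, $b\in\{0,1\}$ and $z$ labels the basis of a workspace of arbitrary finite dimension. It starts in a fixed basis state and applies $U_T\,\mathcal{O}\,U_{T-1}\,\mathcal{O}\cdots U_1\,\mathcal{O}\,U_0$,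 where the unitaries $U_j$ do not depend on the instance and a query $\mathcal{O}$ applies $\mathcal{O}_{S_k}$ to $|i\rangle|b\rangle$, controlled on $k$. It then measures in the computational basis and accepts if the outcome lies in a fixed set. Call $Q$ an $\mathsf{SBQP}$ algorithm for $\mathsf{AND}_2\circ\mathsf{ApxCount}_{N,w}$ if there is a real $\alpha>0$, independent of the instance but otherwise arbitrary (possibly exponentially small in $N$), such that $Q$ accepts every yes instance with probability at least $2\alpha$ and every no instance with probability at most $\alpha$. **Theorem.** There is a universal constant $c>0$ such that for all integers $w\ge1$ and $N\ge 2w$, every $\mathsf{SBQP}$ algorithm for $\mathsf{AND}_2\circ\mathsf{ApxCount}_{N,w}$ that makes $T$ queries satisfies $$T\ \ge\ c\cdot\min\Bigl\{w,\sqrt{N/w}\Bigr\}.$$ -/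

import Mathlib

namespace SBQPQuery

/-- A promise problem on a set of instances: disjoint sets of yes and no instances. -/
structure PromiseProblem (X : Type) where
  yes : Set X
  no : Set X
  disj : Disjoint yes no

/-- `ApxCount_{N,w}`: given a nonempty `S ⊆ [N]`, decide whether `|S| ≥ 2w` (yes) or
`|S| ≤ w` (no). -/
def ApxCount (N w : ℕ) : PromiseProblem (Finset (Fin N)) where
  yes := {S | S.Nonempty ∧ 2 * w ≤ S.card}
  no := {S | S.Nonempty ∧ S.card ≤ w}
  disj := by
    rw [Set.disjoint_left]
    rintro S ⟨hS, h2⟩ ⟨_, h1⟩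
    have := hS.card_pos
    omega

/-- `AND₂ ∘ f`: both instances satisfy the promise of `f`; the answer is yes exactly when both
are yes instances. -/
def AND₂ {X : Type} (f : PromiseProblem X) : PromiseProblem (X × X) where
  yes := {x | x.1 ∈ f.yes ∧ x.2 ∈ f.yes}
  no := {x | (x.1 ∈ f.yes ∪ f.no ∧ x.2 ∈ f.yes ∪ f.no) ∧ (x.1 ∈ f.no ∨ x.2 ∈ f.no)}
  disj := by
    rw [Set.disjoint_left]
    rintro x ⟨h1, h2⟩ ⟨_, h | h⟩
    · exact Set.disjoint_left.1 f.disj h1 h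
    · exact Set.disjoint_left.1 f.disj h2 h

/-- Computational basis labels `((k, i, b), z)`: `k` selects one of the two oracles, `i ∈ [N]` is
the queried element, `b` is the control bit of the membership oracle, and `z` labels a basis
state of a `d`-dimensional workspace. -/
abbrev Label (N d : ℕ) : Type := (Bool × Fin N × Bool) × Fin d

/-- The phase `1 - 2 b xᵢ`, where `xᵢ` indicates `i ∈ S`; the membership oracle acts by
`O_S |i⟩|b⟩ = (1 - 2 b xᵢ) |i⟩|b⟩`. -/
def membershipPhase {N : ℕ} (S : Finset (Fin N)) (i : Fin N) (b : Bool) : ℂ :=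
  1 - 2 * (if b then 1 else 0) * (if i ∈ S then 1 else 0)

/-- One query to the pair of membership oracles of `(S₀, S₁)`: on `|k⟩|i⟩|b⟩|z⟩` it applies
`O_{S_k}` to `|i⟩|b⟩`. -/
def pairOracle {N : ℕ} (d : ℕ) (S : Finset (Fin N) × Finset (Fin N)) :
    Matrix (Label N d) (Label N d) ℂ :=
  Matrix.diagonal fun x =>
    membershipPhase (if x.1.1 then S.2 else S.1) x.1.2.1 x.1.2.2

/-- A quantum query algorithm with access to membership oracles of two subsets of `[N]`:
it starts in a computational basis state, applies the unitary `U₀`, then alternates queries with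
the unitaries in the list `rounds` (one query before each of them), and finally measures in the
computational basis, accepting when the outcome lies in `accept`. The starting state, the
unitaries and the accepting outcomes do not depend on the sets. -/
structure QueryAlgorithm (N : ℕ) where
  workDim : ℕ
  start : Label N workDim
  U₀ : Matrix.unitaryGroup (Label N workDim) ℂ
  rounds : List (Matrix.unitaryGroup (Label N workDim) ℂ)
  accept : Finset (Label N workDim)

namespace QueryAlgorithm

variable {N : ℕ} (Q : QueryAlgorithm N)

/-- The number of queries, counting both oracles together. -/
def numQueries : ℕ := Q.rounds.length

/-- The state before the final measurement, for the pair of sets `S`. -/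
def finalState (S : Finset (Fin N) × Finset (Fin N)) : Label N Q.workDim → ℂ :=
  Q.rounds.foldl
    (fun ψ U => Matrix.mulVec U.1 (Matrix.mulVec (pairOracle Q.workDim S) ψ))
    (Matrix.mulVec Q.U₀.1 (Pi.single Q.start 1))

/-- The probability that the algorithm accepts the pair of sets `S`. -/
noncomputable def acceptProb (S : Finset (Fin N) × Finset (Fin N)) : ℝ :=
  ∑ x ∈ Q.accept, ‖Q.finalState S x‖ ^ 2

/-- `Q` is an SBQP algorithm for the promise problem `P`: for some threshold `α > 0` that does not
depend on the instance, `Q` accepts every yes instance with probability at least `2α` and every no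
instance with probability at most `α`. -/
def IsSBQP (P : PromiseProblem (Finset (Fin N) × Finset (Fin N))) : Prop :=
  ∃ α : ℝ, 0 < α ∧ (∀ S ∈ P.yes, 2 * α ≤ Q.acceptProb S) ∧ (∀ S ∈ P.no, Q.acceptProb S ≤ α)

end QueryAlgorithm

end SBQPQuery

/-!
After `T` queries every amplitude is a multilinear polynomial of degree at most `T` in the
indicator vectors of the two sets, so the acceptance probability is one of degree at most `2 T`.

A polynomial of degree less than `w` which is bounded by `c` on the sets of fewer than `w` elements
is at most `c * 3 ^ #S` at every set `S`. This controls the acceptance probability off the promise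
well enough to average it over random sets which contain each element independently, with
probabilities `u` and `v`: the mean is `O(α)` when the expected size of one set is a large multiple
of `w` and that of the other a small fraction of `w`, and at least about `2 α` when both expected
sizes are large multiples of `w`.

On the hyperbola `u = x * exp θ`, `v = x * exp (-θ)` with `x ≈ w / N`, the symmetrised mean is a
polynomial of degree at most `2 T` in `cosh θ`. It is small for `cosh θ` between a constant and a
multiple of `N / w`, but larger by a constant factor at `cosh θ = 1`, and by Chebyshev's extremal
property this forces `T` to be at least of order `√(N / w)`.
-/

namespace SBQPQuery

open Finset

section PairPoly

variable {𝕜 α β : Type*} [DecidableEq α] [DecidableEq β]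

/-- The monomial `∏_{i ∈ R} xᵢ`, as a function of the set `S` with indicator vector `x`. -/
def setMonomial (𝕜 : Type*) [Zero 𝕜] [One 𝕜] (R S : Finset α) : 𝕜 := if R ⊆ S then 1 else 0

/-- The monomial `∏_{i ∈ A} xᵢ ∏_{j ∈ B} yⱼ`, as a function of the pair of sets with indicator
vectors `x` and `y`. -/
def pairMonomial (𝕜 : Type*) [MulZeroOneClass 𝕜] (A : Finset α) (B : Finset β)
    (S : Finset α × Finset β) : 𝕜 :=
  setMonomial 𝕜 A S.1 * setMonomial 𝕜 B S.2

/-- The functions of a pair of finite sets that are multilinear polynomials of total degree at most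
`d` in the two indicator vectors. -/
def pairPoly (𝕜 α β : Type*) [DecidableEq α] [DecidableEq β] [Semiring 𝕜] (d : ℕ) :
    Submodule 𝕜 (Finset α × Finset β → 𝕜) :=
  Submodule.span 𝕜 {f | ∃ A B, #A + #B ≤ d ∧ f = pairMonomial 𝕜 A B}

theorem setMonomial_union [MulZeroOneClass 𝕜] (A B S : Finset α) :
    setMonomial 𝕜 (A ∪ B) S = setMonomial 𝕜 A S * setMonomial 𝕜 B S := by
  simp only [setMonomial, union_subset_iff, ite_and, ite_mul, one_mul, zero_mul]

theorem setMonomial_insert_right [Zero 𝕜] [One 𝕜] (R S : Finset α) (a : α) :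
    setMonomial 𝕜 R (insert a S) = setMonomial 𝕜 (R.erase a) S := by
  simp only [setMonomial, subset_insert_iff]

theorem setMonomial_erase_right [Zero 𝕜] [One 𝕜] (R S : Finset α) (a : α) :
    setMonomial 𝕜 R (S.erase a) = if a ∈ R then 0 else setMonomial 𝕜 R S := by
  by_cases ha : a ∈ R <;> simp [setMonomial, subset_erase, ha]

theorem pairMonomial_mem_pairPoly [Semiring 𝕜] {d : ℕ} {A : Finset α} {B : Finset β}
    (h : #A + #B ≤ d) : pairMonomial 𝕜 A B ∈ pairPoly 𝕜 α β d :=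
  Submodule.subset_span ⟨A, B, h, rfl⟩

theorem map_mem_of_mem_pairPoly [Semiring 𝕜] {M : Type*} [AddCommMonoid M] [Module 𝕜 M]
    {P : Submodule 𝕜 M} {d : ℕ} (L : (Finset α × Finset β → 𝕜) →ₗ[𝕜] M)
    (hL : ∀ A B, #A + #B ≤ d → L (pairMonomial 𝕜 A B) ∈ P)
    {f : Finset α × Finset β → 𝕜} (hf : f ∈ pairPoly 𝕜 α β d) : L f ∈ P := by
  refine (Submodule.span_le (p := P.comap L)).2 ?_ hf
  rintro _ ⟨A, B, h, rfl⟩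
  exact hL A B h

theorem const_mem_pairPoly [Semiring 𝕜] (c : 𝕜) (d : ℕ) : (fun _ => c) ∈ pairPoly 𝕜 α β d := by
  have h : pairMonomial 𝕜 (∅ : Finset α) (∅ : Finset β) ∈ pairPoly 𝕜 α β d :=
    pairMonomial_mem_pairPoly (by simp)
  convert Submodule.smul_mem _ c h using 1
  ext S
  simp [pairMonomial, setMonomial]

theorem apply_eq_apply_of_mem_pairPoly_zero [Semiring 𝕜] {f : Finset α × Finset β → 𝕜}
    (hf : f ∈ pairPoly 𝕜 α β 0) (S T : Finset α × Finset β) : f S = f T := by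
  refine map_mem_of_mem_pairPoly (P := LinearMap.eqLocus (LinearMap.proj S) (LinearMap.proj T))
    LinearMap.id (fun A B h => ?_) hf
  obtain ⟨rfl, rfl⟩ : A = ∅ ∧ B = ∅ := by simpa using h
  simp [pairMonomial, setMonomial]

theorem mul_mem_pairPoly [CommSemiring 𝕜] {d e : ℕ} {f g : Finset α × Finset β → 𝕜}
    (hf : f ∈ pairPoly 𝕜 α β d) (hg : g ∈ pairPoly 𝕜 α β e) : f * g ∈ pairPoly 𝕜 α β (d + e) := by
  refine map_mem_of_mem_pairPoly (LinearMap.mulRight 𝕜 g) (fun A B h => ?_) hf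
  refine map_mem_of_mem_pairPoly (LinearMap.mulLeft 𝕜 (pairMonomial 𝕜 A B)) (fun A' B' h' => ?_) hg
  have hcard : #(A ∪ A') + #(B ∪ B') ≤ d + e := by
    have := card_union_le A A'
    have := card_union_le B B'
    omega
  convert pairMonomial_mem_pairPoly (𝕜 := 𝕜) hcard using 1
  ext S
  simp only [LinearMap.mulLeft_apply, Pi.mul_apply, pairMonomial, setMonomial_union]
  ring

theorem swap_mem_pairPoly [CommSemiring 𝕜] {d : ℕ} {f : Finset α × Finset β → 𝕜}
    (hf : f ∈ pairPoly 𝕜 α β d) : f ∘ Prod.swap ∈ pairPoly 𝕜 β α d := by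
  refine map_mem_of_mem_pairPoly (LinearMap.funLeft 𝕜 𝕜 Prod.swap) (fun A B h => ?_) hf
  convert pairMonomial_mem_pairPoly (𝕜 := 𝕜) ((add_comm #B #A).trans_le h) using 1
  ext S
  exact mul_comm _ _

theorem insert_mem_pairPoly [Semiring 𝕜] {d : ℕ} {f : Finset α × Finset β → 𝕜}
    (hf : f ∈ pairPoly 𝕜 α β d) (a : α) (b : β) :
    (fun S => f (insert a S.1, insert b S.2)) ∈ pairPoly 𝕜 α β d := by
  refine map_mem_of_mem_pairPoly
    (LinearMap.funLeft 𝕜 𝕜 (Prod.map (insert a) (insert b))) (fun A B h => ?_) hf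
  convert pairMonomial_mem_pairPoly (𝕜 := 𝕜)
    ((add_le_add (card_erase_le (a := a)) (card_erase_le (a := b))).trans h) using 1
  ext S
  simp only [LinearMap.funLeft_apply, Prod.map, pairMonomial, setMonomial_insert_right]

theorem sub_mem_pairPoly_of_succ [Ring 𝕜] {d : ℕ} {f : Finset α × Finset β → 𝕜}
    (hf : f ∈ pairPoly 𝕜 α β (d + 1)) (a : α) :
    (fun S => f (insert a S.1, S.2) - f (S.1.erase a, S.2)) ∈ pairPoly 𝕜 α β d := by
  refine map_mem_of_mem_pairPoly (LinearMap.funLeft 𝕜 𝕜 (Prod.map (insert a) id) -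
    LinearMap.funLeft 𝕜 𝕜 (Prod.map (erase · a) id)) (fun A B h => ?_) hf
  by_cases ha : a ∈ A
  · have hcard : #(A.erase a) + #B ≤ d := by
      have := card_erase_add_one ha
      omega
    convert pairMonomial_mem_pairPoly (𝕜 := 𝕜) hcard using 1
    ext S
    simp [LinearMap.funLeft_apply, pairMonomial, setMonomial_insert_right, setMonomial_erase_right,
      ha]
  · convert (pairPoly 𝕜 α β d).zero_mem using 1
    ext S
    simp [LinearMap.funLeft_apply, pairMonomial, setMonomial_insert_right, setMonomial_erase_right,
      ha]

theorem re_const_mul_mem_pairPoly {d : ℕ} {f : Finset α × Finset β → ℂ}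
    (hf : f ∈ pairPoly ℂ α β d) (c : ℂ) : (fun S => (c * f S).re) ∈ pairPoly ℝ α β d := by
  induction hf using Submodule.span_induction generalizing c with
  | mem f hf =>
    obtain ⟨A, B, h, rfl⟩ := hf
    convert Submodule.smul_mem _ c.re (pairMonomial_mem_pairPoly (𝕜 := ℝ) h) using 1
    ext S
    simp only [pairMonomial, setMonomial, Pi.smul_apply, smul_eq_mul]
    split_ifs <;> simp
  | zero => simpa using const_mem_pairPoly (0 : ℝ) d
  | add f g _ _ hf hg =>
    simp only [Pi.add_apply, mul_add, Complex.add_re]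
    exact add_mem (hf c) (hg c)
  | smul b f _ hf => simpa only [Pi.smul_apply, smul_eq_mul, mul_assoc] using hf (c * b)

theorem norm_sq_mem_pairPoly {d : ℕ} {f : Finset α × Finset β → ℂ} (hf : f ∈ pairPoly ℂ α β d) :
    (fun S => ‖f S‖ ^ 2) ∈ pairPoly ℝ α β (2 * d) := by
  have hre := re_const_mul_mem_pairPoly hf 1
  have him := re_const_mul_mem_pairPoly hf (-Complex.I)
  rw [two_mul]
  convert add_mem (mul_mem_pairPoly hre hre) (mul_mem_pairPoly him him) using 1
  ext S
  simp [Complex.sq_norm, Complex.normSq_apply]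

theorem abs_le_mul_three_pow_card {d : ℕ} {f : Finset α × Finset β → ℝ}
    (hf : f ∈ pairPoly ℝ α β d) {B : Finset β} {c : ℝ} (hc : ∀ A, #A ≤ d → |f (A, B)| ≤ c)
    (A : Finset α) : |f (A, B)| ≤ c * 3 ^ #A := by
  induction A using Finset.induction_on generalizing d f c with
  | empty => simpa using hc ∅ (by simp)
  | insert a A ha ih =>
    have hc0 : 0 ≤ c := (abs_nonneg _).trans (hc ∅ (by simp))
    cases d with
    | zero =>
      rw [apply_eq_apply_of_mem_pairPoly_zero hf _ (∅, B)]
      exact (hc ∅ (by simp)).trans (le_mul_of_one_le_right hc0 (one_le_pow₀ (by norm_num)))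
    | succ d =>
      have hdiff : ∀ R, #R ≤ d → |f (insert a R, B) - f (R.erase a, B)| ≤ 2 * c := fun R hR =>
        calc |f (insert a R, B) - f (R.erase a, B)|
            ≤ |f (insert a R, B)| + |f (R.erase a, B)| := abs_sub _ _
          _ ≤ c + c := add_le_add (hc _ ((card_insert_le a R).trans (by omega)))
              (hc _ (card_erase_le.trans (by omega)))
          _ = 2 * c := (two_mul c).symm
      have hA := ih (sub_mem_pairPoly_of_succ hf a) hdiff
      rw [erase_eq_of_notMem ha] at hA
      calc |f (insert a A, B)|
          = |(f (insert a A, B) - f (A, B)) + f (A, B)| := by rw [sub_add_cancel]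
        _ ≤ 2 * c * 3 ^ #A + c * 3 ^ #A := (abs_add_le _ _).trans (add_le_add hA (ih hf hc))
        _ = c * 3 ^ #(insert a A) := by rw [card_insert_of_notMem ha]; ring

end PairPoly

section Amplitudes

variable {N : ℕ}

theorem mulVec_mem_pairPoly {𝕜 α β m n : Type*} [DecidableEq α] [DecidableEq β] [CommSemiring 𝕜]
    [Fintype n] {d : ℕ} (M : Matrix m n 𝕜) {ψ : Finset α × Finset β → n → 𝕜}
    (hψ : ∀ y, (fun S => ψ S y) ∈ pairPoly 𝕜 α β d) (x : m) :
    (fun S => M.mulVec (ψ S) x) ∈ pairPoly 𝕜 α β d := by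
  convert Submodule.sum_mem (t := univ) _ (fun y _ => Submodule.smul_mem _ (M x y) (hψ y)) using 1
  ext S
  simp [Matrix.mulVec, dotProduct]

theorem membershipPhase_mem_pairPoly (k : Bool) (i : Fin N) (b : Bool) :
    (fun S : Finset (Fin N) × Finset (Fin N) =>
      membershipPhase (if k then S.2 else S.1) i b) ∈ pairPoly ℂ (Fin N) (Fin N) 1 := by
  have hvar : pairMonomial ℂ (if k then ∅ else {i}) (if k then {i} else ∅) ∈
      pairPoly ℂ (Fin N) (Fin N) 1 := pairMonomial_mem_pairPoly (by cases k <;> simp)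
  convert sub_mem (const_mem_pairPoly 1 1)
    (Submodule.smul_mem _ (2 * if b then 1 else 0) hvar) using 1
  ext S
  cases k <;> cases b <;> simp [membershipPhase, pairMonomial, setMonomial]

theorem pairOracle_mulVec_mem_pairPoly {d n : ℕ}
    {ψ : Finset (Fin N) × Finset (Fin N) → Label N n → ℂ}
    (hψ : ∀ x, (fun S => ψ S x) ∈ pairPoly ℂ (Fin N) (Fin N) d) (x : Label N n) :
    (fun S => (pairOracle n S).mulVec (ψ S) x) ∈ pairPoly ℂ (Fin N) (Fin N) (d + 1) := by
  convert mul_mem_pairPoly (hψ x) (membershipPhase_mem_pairPoly x.1.1 x.1.2.1 x.1.2.2) using 1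
  ext S
  simp [pairOracle, Matrix.mulVec_diagonal, mul_comm]

theorem foldl_mem_pairPoly {d n : ℕ} (rounds : List (Matrix.unitaryGroup (Label N n) ℂ))
    {ψ : Finset (Fin N) × Finset (Fin N) → Label N n → ℂ}
    (hψ : ∀ x, (fun S => ψ S x) ∈ pairPoly ℂ (Fin N) (Fin N) d) (x : Label N n) :
    (fun S => rounds.foldl (fun φ U => U.1.mulVec ((pairOracle n S).mulVec φ)) (ψ S) x) ∈
      pairPoly ℂ (Fin N) (Fin N) (d + rounds.length) := by
  induction rounds generalizing d ψ with
  | nil => exact hψ x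
  | cons U rounds ih =>
    rw [List.length_cons, add_comm rounds.length, ← add_assoc]
    exact ih (mulVec_mem_pairPoly U.1 (pairOracle_mulVec_mem_pairPoly hψ))

theorem finalState_mem_pairPoly (Q : QueryAlgorithm N) (x : Label N Q.workDim) :
    (fun S => Q.finalState S x) ∈ pairPoly ℂ (Fin N) (Fin N) Q.numQueries := by
  have h := foldl_mem_pairPoly Q.rounds (d := 0)
    (ψ := fun _ => Q.U₀.1.mulVec (Pi.single Q.start 1)) (fun _ => const_mem_pairPoly _ 0) x
  rwa [zero_add] at h

theorem acceptProb_mem_pairPoly (Q : QueryAlgorithm N) :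
    Q.acceptProb ∈ pairPoly ℝ (Fin N) (Fin N) (2 * Q.numQueries) := by
  convert Submodule.sum_mem (t := Q.accept) _
    fun x _ => norm_sq_mem_pairPoly (finalState_mem_pairPoly Q x) using 1
  ext S
  simp [QueryAlgorithm.acceptProb]

theorem acceptProb_nonneg (Q : QueryAlgorithm N) (S : Finset (Fin N) × Finset (Fin N)) :
    0 ≤ Q.acceptProb S :=
  sum_nonneg fun _ _ => sq_nonneg _

end Amplitudes

section BernoulliMean

variable {ι κ : Type*} [Fintype ι] [DecidableEq ι] [Fintype κ] [DecidableEq κ]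

/-- The probability that a random set which contains each element independently with probability
`u` equals `S`. -/
def bernoulliWeight (u : ℝ) (S : Finset ι) : ℝ := u ^ #S * (1 - u) ^ #Sᶜ

/-- The expectation of a function of a random set which contains each element independently with
probability `u`. -/
def bernoulliMean (u : ℝ) : (Finset ι → ℝ) →ₗ[ℝ] ℝ where
  toFun f := ∑ S, bernoulliWeight u S * f S
  map_add' f g := by simp only [Pi.add_apply, mul_add, sum_add_distrib]
  map_smul' c f := by
    simp only [Pi.smul_apply, smul_eq_mul, mul_left_comm, mul_sum, RingHom.id_apply]

/-- The expectation of a function of two independent random sets, which contain each element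
independently with probability `u` and `v` respectively. -/
def pairMean (u v : ℝ) : (Finset ι × Finset κ → ℝ) →ₗ[ℝ] ℝ where
  toFun f := bernoulliMean u fun A => bernoulliMean v fun B => f (A, B)
  map_add' f g := by
    rw [← map_add]
    exact congrArg _ (funext fun A => map_add (bernoulliMean v) (fun B => f (A, B)) _)
  map_smul' c f := by
    rw [← map_smul]
    exact congrArg _ (funext fun A => map_smul (bernoulliMean v) c fun B => f (A, B))

theorem pairMean_apply (u v : ℝ) (f : Finset ι × Finset κ → ℝ) :
    pairMean u v f = bernoulliMean u fun A => bernoulliMean v fun B => f (A, B) := rfl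

theorem bernoulliWeight_nonneg {u : ℝ} (hu : u ∈ Set.Icc 0 1) (S : Finset ι) :
    0 ≤ bernoulliWeight u S :=
  mul_nonneg (pow_nonneg hu.1 _) (pow_nonneg (sub_nonneg.2 hu.2) _)

theorem bernoulliMean_mono {u : ℝ} (hu : u ∈ Set.Icc 0 1) :
    Monotone (bernoulliMean u : (Finset ι → ℝ) → ℝ) := fun _ _ h =>
  sum_le_sum fun S _ => mul_le_mul_of_nonneg_left (h S) (bernoulliWeight_nonneg hu S)

theorem bernoulliMean_pow_card (u y : ℝ) :
    bernoulliMean u (fun S : Finset ι => y ^ #S) = (u * y + (1 - u)) ^ Fintype.card ι := by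
  rw [← Fintype.sum_pow_mul_eq_add_pow]
  refine sum_congr rfl fun S _ => ?_
  rw [bernoulliWeight, card_compl, mul_pow]
  ring

theorem bernoulliMean_one (u : ℝ) : bernoulliMean u (1 : Finset ι → ℝ) = 1 := by
  simpa [Pi.one_def] using bernoulliMean_pow_card (ι := ι) u 1

theorem bernoulliMean_one_add_const_mul (u c : ℝ) (f : Finset ι → ℝ) :
    bernoulliMean u (fun S => 1 + c * f S) = 1 + c * bernoulliMean u f := by
  have h : bernoulliMean u (1 + c • f) = 1 + c * bernoulliMean u f := by
    rw [map_add, map_smul, bernoulliMean_one, smul_eq_mul]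
  exact h

theorem bernoulliMean_pow_card_le {u y : ℝ} (hu : u ∈ Set.Icc 0 1) (hy : 0 ≤ y) :
    bernoulliMean u (fun S : Finset ι => y ^ #S) ≤
      Real.exp (u * Fintype.card ι * (y - 1)) := by
  have h0 : 0 ≤ u * y + (1 - u) := add_nonneg (mul_nonneg hu.1 hy) (sub_nonneg.2 hu.2)
  calc bernoulliMean u (fun S : Finset ι => y ^ #S)
      = (u * (y - 1) + 1) ^ Fintype.card ι := by rw [bernoulliMean_pow_card]; ring
    _ ≤ Real.exp (u * (y - 1)) ^ Fintype.card ι :=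
      pow_le_pow_left₀ (by linarith) (Real.add_one_le_exp _) _
    _ = Real.exp (u * Fintype.card ι * (y - 1)) := by rw [← Real.exp_nat_mul]; ring_nf

theorem bernoulliMean_setMonomial (u : ℝ) (R : Finset ι) :
    bernoulliMean u (setMonomial ℝ R) = u ^ #R := by
  have hterm (S : Finset ι) : bernoulliWeight u S * setMonomial ℝ R S =
      (∏ _i ∈ S, u) * ∏ i ∈ Sᶜ, if i ∈ R then 0 else 1 - u := by
    rw [bernoulliWeight, mul_assoc, prod_const]
    by_cases hR : R ⊆ S
    · have : ∀ i ∈ Sᶜ, (if i ∈ R then 0 else 1 - u) = 1 - u := fun i hi =>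
        if_neg fun hiR => mem_compl.1 hi (hR hiR)
      rw [setMonomial, if_pos hR, mul_one, prod_congr rfl this, prod_const]
    · obtain ⟨i, hiR, hiS⟩ := not_subset.1 hR
      have : ∏ i ∈ Sᶜ, (if i ∈ R then 0 else 1 - u) = 0 :=
        prod_eq_zero (mem_compl.2 hiS) (if_pos hiR)
      rw [setMonomial, if_neg hR, mul_zero, this, mul_zero]
  calc bernoulliMean u (setMonomial ℝ R)
      = ∑ S, (∏ _i ∈ S, u) * ∏ i ∈ Sᶜ, if i ∈ R then 0 else 1 - u :=
        sum_congr rfl fun S _ => hterm S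
    _ = ∏ i, (u + if i ∈ R then 0 else 1 - u) := (Fintype.prod_add _ _).symm
    _ = ∏ i, if i ∈ R then u else 1 := by
        refine prod_congr rfl fun i _ => ?_
        split_ifs <;> ring
    _ = u ^ #R := by rw [prod_ite_mem, univ_inter, prod_const]

theorem pairMean_mul (u v : ℝ) (f : Finset ι → ℝ) (g : Finset κ → ℝ) :
    pairMean u v (fun S => f S.1 * g S.2) = bernoulliMean u f * bernoulliMean v g := by
  have h : (fun A => bernoulliMean v fun B => f A * g B) = bernoulliMean v g • f :=
    funext fun A => (map_smul (bernoulliMean v) (f A) g).trans (mul_comm _ _)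
  rw [pairMean_apply, h, map_smul, smul_eq_mul, mul_comm]

theorem pairMean_fst (u v : ℝ) (f : Finset ι → ℝ) :
    pairMean u v (fun S : Finset ι × Finset κ => f S.1) = bernoulliMean u f := by
  simpa [bernoulliMean_one] using pairMean_mul (κ := κ) u v f 1

theorem pairMean_snd (u v : ℝ) (g : Finset κ → ℝ) :
    pairMean u v (fun S : Finset ι × Finset κ => g S.2) = bernoulliMean v g := by
  simpa [bernoulliMean_one] using pairMean_mul (ι := ι) u v 1 g

theorem pairMean_one (u v : ℝ) : pairMean u v (1 : Finset ι × Finset κ → ℝ) = 1 :=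
  (pairMean_fst u v 1).trans (bernoulliMean_one u)

theorem pairMean_mono {u v : ℝ} (hu : u ∈ Set.Icc 0 1) (hv : v ∈ Set.Icc 0 1) :
    Monotone (pairMean u v : (Finset ι × Finset κ → ℝ) → ℝ) := fun _ _ h =>
  bernoulliMean_mono hu fun A => bernoulliMean_mono hv fun B => h (A, B)

theorem abs_pairMean_le {u v : ℝ} (hu : u ∈ Set.Icc 0 1) (hv : v ∈ Set.Icc 0 1)
    {f g : Finset ι × Finset κ → ℝ} (h : ∀ S, |f S| ≤ g S) :
    |pairMean u v f| ≤ pairMean u v g := by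
  refine abs_le.2 ⟨?_, pairMean_mono hu hv fun S => (abs_le.1 (h S)).2⟩
  rw [← map_neg]
  exact pairMean_mono hu hv fun S => (abs_le.1 (h S)).1

theorem pairMean_pairMonomial (u v : ℝ) (A : Finset ι) (B : Finset κ) :
    pairMean u v (pairMonomial ℝ A B) = u ^ #A * v ^ #B := by
  rw [← bernoulliMean_setMonomial, ← bernoulliMean_setMonomial]
  exact pairMean_mul u v _ _

theorem pairMean_exp_pairMonomial_add (x θ : ℝ) (A B : Finset ι) :
    pairMean (x * Real.exp θ) (x * Real.exp (-θ)) (pairMonomial ℝ A B + pairMonomial ℝ B A) =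
      2 * x ^ (#A + #B) * Real.cosh ((#A - #B : ℤ) * θ) := by
  have harg : ((#A - #B : ℤ) : ℝ) * θ = #A * θ + #B * -θ := by push_cast; ring
  have hneg : -(#A * θ + #B * -θ) = #A * -θ + #B * θ := by ring
  rw [map_add, pairMean_pairMonomial, pairMean_pairMonomial, harg, Real.cosh_eq, hneg,
    Real.exp_add, Real.exp_add]
  simp only [Real.exp_nat_mul, mul_pow]
  ring

theorem exists_polynomial_eval_cosh_eq_pairMean {d : ℕ} {f : Finset ι × Finset ι → ℝ}
    (hf : f ∈ pairPoly ℝ ι ι d) (x : ℝ) :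
    ∃ p : Polynomial ℝ, p.natDegree ≤ d ∧ ∀ θ, p.eval (Real.cosh θ) =
      pairMean (x * Real.exp θ) (x * Real.exp (-θ)) (f + f ∘ Prod.swap) := by
  let evalCosh : Polynomial ℝ →ₗ[ℝ] ℝ → ℝ := LinearMap.pi fun θ => Polynomial.leval (Real.cosh θ)
  let mean : (Finset ι × Finset ι → ℝ) →ₗ[ℝ] ℝ → ℝ := LinearMap.pi fun θ =>
    pairMean (x * Real.exp θ) (x * Real.exp (-θ)) ∘ₗ
      (LinearMap.id + LinearMap.funLeft ℝ ℝ Prod.swap)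
  suffices h : mean f ∈ (Polynomial.degreeLE ℝ d).map evalCosh by
    obtain ⟨p, hp, hpf⟩ := Submodule.mem_map.1 h
    exact ⟨p, Polynomial.natDegree_le_of_degree_le (Polynomial.mem_degreeLE.1 hp), congrFun hpf⟩
  refine map_mem_of_mem_pairPoly mean (fun A B h => ?_) hf
  let p : Polynomial ℝ := .C (2 * x ^ (#A + #B)) * Polynomial.Chebyshev.T ℝ (#A - #B)
  have hp : p.natDegree ≤ d := (Polynomial.natDegree_C_mul_le _ _).trans <| by
    rw [Polynomial.Chebyshev.natDegree_T]
    omega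
  have hswap : LinearMap.funLeft ℝ ℝ Prod.swap (pairMonomial ℝ A B) = pairMonomial ℝ B A :=
    funext fun S => mul_comm _ _
  have hpf (θ : ℝ) : p.eval (Real.cosh θ) = mean (pairMonomial ℝ A B) θ :=
    calc p.eval (Real.cosh θ)
        = 2 * x ^ (#A + #B) * Real.cosh ((#A - #B : ℤ) * θ) := by
          rw [Polynomial.eval_C_mul, Polynomial.Chebyshev.T_real_cosh]
      _ = pairMean (x * Real.exp θ) (x * Real.exp (-θ))
            (pairMonomial ℝ A B + LinearMap.funLeft ℝ ℝ Prod.swap (pairMonomial ℝ A B)) := by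
          rw [hswap, pairMean_exp_pairMonomial_add]
  exact Submodule.mem_map.2
    ⟨p, Polynomial.mem_degreeLE.2 (Polynomial.degree_le_of_natDegree_le hp), funext hpf⟩

end BernoulliMean

section ChebyshevGrowth

open Polynomial

theorem half_sq_le_cosh_sub_one (θ : ℝ) : θ ^ 2 / 2 ≤ Real.cosh θ - 1 := by
  have hsinh : (θ / 2) ^ 2 ≤ Real.sinh (θ / 2) ^ 2 := by
    rw [← sq_abs, ← sq_abs (Real.sinh _), Real.abs_sinh]
    exact pow_le_pow_left₀ (abs_nonneg _) (Real.self_le_sinh_iff.2 (abs_nonneg _)) 2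
  have hcosh := Real.cosh_two_mul (θ / 2)
  rw [mul_div_cancel₀ θ two_ne_zero, Real.cosh_sq] at hcosh
  linarith

theorem eval_chebyshev_T_le_exp (n : ℕ) {x : ℝ} (hx : 1 ≤ x) :
    (Chebyshev.T ℝ n).eval x ≤ Real.exp (n ^ 2 * (x - 1)) := by
  obtain ⟨θ, rfl⟩ : ∃ θ, Real.cosh θ = x := ⟨_, Real.cosh_arcosh hx⟩
  rw [Chebyshev.T_real_cosh, Int.cast_natCast]
  refine (Real.cosh_le_exp_half_sq _).trans (Real.exp_le_exp.2 ?_)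
  calc (n * θ) ^ 2 / 2 = n ^ 2 * (θ ^ 2 / 2) := by ring
    _ ≤ n ^ 2 * (Real.cosh θ - 1) :=
      mul_le_mul_of_nonneg_left (half_sq_le_cosh_sub_one θ) (sq_nonneg _)

theorem eval_le_mul_exp_of_abs_le {n : ℕ} {p : ℝ[X]} (hp : p.natDegree ≤ n) {a b c x : ℝ}
    (hab : a < b) (hc : 0 < c) (hx : x ≤ a) (h : ∀ t ∈ Set.Icc a b, |p.eval t| ≤ c) :
    p.eval x ≤ c * Real.exp (n ^ 2 * (2 * (a - x) / (b - a))) := by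
  have hba : 0 < b - a := sub_pos.2 hab
  let ℓ : ℝ[X] := C ((a + b) / 2) - C ((b - a) / 2) * X
  let q : ℝ[X] := C c⁻¹ * p.comp ℓ
  let y := 1 + 2 * (a - x) / (b - a)
  have hℓ (s : ℝ) : ℓ.eval s = (a + b) / 2 - (b - a) / 2 * s := by simp [ℓ]
  have hq (s : ℝ) : q.eval s = c⁻¹ * p.eval (ℓ.eval s) := by simp [q]
  have hqdeg : q.degree ≤ n := by
    have hℓdeg : ℓ.natDegree ≤ 1 := by simp only [ℓ]; compute_degree
    refine degree_le_of_natDegree_le ((natDegree_C_mul_le _ _).trans (natDegree_comp_le.trans ?_))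
    simpa using Nat.mul_le_mul hp hℓdeg
  have hqbound : ∀ s ∈ Set.Icc (-1 : ℝ) 1, |q.eval s| ≤ 1 := by
    rintro s ⟨hs₁, hs₂⟩
    have hmem : ℓ.eval s ∈ Set.Icc a b := by
      rw [hℓ]
      constructor <;> nlinarith
    rw [hq, abs_mul, abs_of_pos (inv_pos.2 hc), inv_mul_le_one₀ hc]
    exact h _ hmem
  have hy : 1 ≤ y := le_add_of_nonneg_right (div_nonneg (by linarith) hba.le)
  have hℓy : ℓ.eval y = x := by
    rw [hℓ]
    simp only [y]
    field_simp
    ring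
  have hqy := (Chebyshev.eval_iterate_derivative_le_of_forall_abs_le_one (k := 0) hy hqdeg
    hqbound).trans (eval_chebyshev_T_le_exp n hy)
  rwa [Function.iterate_zero_apply, hq, hℓy, inv_mul_le_iff₀ hc, add_sub_cancel_left] at hqy

end ChebyshevGrowth

section GrowthOffPromise

variable {w d : ℕ}

theorem pow_le_pow_mul_half_pow {a : ℝ} {k : ℕ} (ha : 1 ≤ a) (hk : k ≤ 2 * w) :
    a ^ k ≤ ((2 * a) ^ 2) ^ w * (1 / 2) ^ k :=
  calc a ^ k = (2 * a) ^ k * (1 / 2) ^ k := by rw [← mul_pow]; ring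
    _ ≤ (2 * a) ^ (2 * w) * (1 / 2) ^ k := by gcongr; linarith
    _ = ((2 * a) ^ 2) ^ w * (1 / 2) ^ k := by rw [pow_mul]

theorem three_pow_le_mul_pow {k : ℕ} (hk : w ≤ k) : (3 : ℝ) ^ k ≤ (1 / 100) ^ w * 300 ^ k :=
  calc (3 : ℝ) ^ k = (1 / 100) ^ k * 300 ^ k := by rw [← mul_pow]; norm_num
    _ ≤ (1 / 100) ^ w * 300 ^ k :=
      mul_le_mul_of_nonneg_right (pow_le_pow_of_le_one (by norm_num) (by norm_num) hk)
        (by positivity)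

theorem mul_one_sub_half_pow_le_of_le_card {ι κ : Type*} {f : Finset ι × Finset κ → ℝ} {c : ℝ}
    (hf : ∀ S, 0 ≤ f S) (hc0 : 0 ≤ c) (hc : ∀ A B, 2 * w ≤ #A → 2 * w ≤ #B → c ≤ f (A, B))
    (A : Finset ι) (B : Finset κ) :
    c * (1 - 4 ^ w * (1 / 2) ^ #A - 4 ^ w * (1 / 2) ^ #B) ≤ f (A, B) := by
  have htail_nonneg (k : ℕ) : (0 : ℝ) ≤ 4 ^ w * (1 / 2) ^ k := by positivity
  have one_le_tail {k : ℕ} (hk : ¬ 2 * w ≤ k) : (1 : ℝ) ≤ 4 ^ w * (1 / 2) ^ k := by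
    have h := pow_le_pow_mul_half_pow (w := w) (k := k) (le_refl (1 : ℝ)) (by omega)
    norm_num at h ⊢
    exact h
  have hA0 := htail_nonneg #A
  have hB0 := htail_nonneg #B
  by_cases h : 2 * w ≤ #A ∧ 2 * w ≤ #B
  · exact (mul_le_of_le_one_right hc0 (by linarith)).trans (hc A B h.1 h.2)
  · refine (mul_nonpos_of_nonneg_of_nonpos hc0 ?_).trans (hf _)
    rcases not_and_or.1 h with hA | hB
    · linarith [one_le_tail hA]
    · linarith [one_le_tail hB]

-- The bounds `3 ^ #A` and `3 ^ #B` on the growth are traded for terms of small mean, the former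
-- when `#A` is typically much larger than `2 w`, the latter when `#B` is typically much smaller
-- than `w`.
theorem abs_le_of_abs_le_of_card_lt {ι κ : Type*} [DecidableEq ι] [DecidableEq κ]
    {f : Finset ι × Finset κ → ℝ} {c : ℝ} (hdw : d < w) (hf : f ∈ pairPoly ℝ ι κ d)
    (hc : ∀ A B, #B < w → #A < w ∨ 2 * w ≤ #A → |f (A, B)| ≤ c) (A : Finset ι) (B : Finset κ) :
    |f (A, B)| ≤ c * ((1 + 36 ^ w * (1 / 2) ^ #A) * (1 + (1 / 100) ^ w * 300 ^ #B)) := by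
  have hw : 0 < w := hdw.pos
  have hc0 : 0 ≤ c := (abs_nonneg _).trans (hc ∅ ∅ (by simpa) (by simp [hw]))
  have hsmall : ∀ B : Finset κ, #B < w → |f (A, B)| ≤ c * (1 + 36 ^ w * (1 / 2) ^ #A) := by
    intro B hB
    by_cases hA : #A < w ∨ 2 * w ≤ #A
    · exact (hc A B hB hA).trans
        (le_mul_of_one_le_right hc0 (le_add_of_nonneg_right (by positivity)))
    · calc |f (A, B)| ≤ c * 3 ^ #A :=
            abs_le_mul_three_pow_card hf (fun R hR => hc R B hB (.inl (hR.trans_lt hdw))) A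
        _ ≤ c * (1 + 36 ^ w * (1 / 2) ^ #A) := by
          have := pow_le_pow_mul_half_pow (w := w) (k := #A) (by norm_num : (1 : ℝ) ≤ 3) (by omega)
          gcongr
          norm_num at this ⊢
          linarith
  rw [← mul_assoc]
  have hcA : 0 ≤ c * (1 + 36 ^ w * (1 / 2) ^ #A) := by positivity
  by_cases hB : #B < w
  · exact (hsmall B hB).trans
      (le_mul_of_one_le_right hcA (le_add_of_nonneg_right (by positivity)))
  · calc |f (A, B)| ≤ c * (1 + 36 ^ w * (1 / 2) ^ #A) * 3 ^ #B :=
          abs_le_mul_three_pow_card (swap_mem_pairPoly hf)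
            (fun R hR => hsmall R (hR.trans_lt hdw)) B
      _ ≤ c * (1 + 36 ^ w * (1 / 2) ^ #A) * (1 + (1 / 100) ^ w * 300 ^ #B) := by
        have := three_pow_le_mul_pow (not_lt.1 hB)
        gcongr
        linarith

end GrowthOffPromise

section MeanBounds

variable {ι κ : Type*} [Fintype ι] [DecidableEq ι] [Fintype κ] [DecidableEq κ] {w d : ℕ}

theorem pow_mul_bernoulliMean_half_pow_le (hw : 1 ≤ w) {u c : ℝ} (hu : u ∈ Set.Icc 0 1)
    (hun : 20 * w ≤ u * Fintype.card ι) (hc : c ∈ Set.Icc 0 1024) :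
    c ^ w * bernoulliMean u (fun S : Finset ι => (1 / 2) ^ #S) ≤ c / 1024 := by
  have hexp : Real.exp (-10) ≤ 1 / 1024 := by
    have h : (2 : ℝ) ^ 10 ≤ Real.exp 1 ^ 10 :=
      pow_le_pow_left₀ zero_le_two (by linarith [Real.add_one_le_exp 1]) 10
    rw [← Real.exp_nat_mul] at h
    rw [Real.exp_neg, one_div]
    exact inv_anti₀ (by norm_num) (by norm_num at h ⊢; exact h)
  have hmean : bernoulliMean u (fun S : Finset ι => (1 / 2) ^ #S) ≤ (1 / 1024) ^ w :=
    calc bernoulliMean u (fun S : Finset ι => (1 / 2) ^ #S)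
        ≤ Real.exp (u * Fintype.card ι * (1 / 2 - 1)) :=
          bernoulliMean_pow_card_le hu (by norm_num)
      _ ≤ Real.exp (w * (-10)) := Real.exp_le_exp.2 (by linarith)
      _ = Real.exp (-10) ^ w := Real.exp_nat_mul _ _
      _ ≤ (1 / 1024) ^ w := pow_le_pow_left₀ (Real.exp_nonneg _) hexp w
  calc c ^ w * bernoulliMean u (fun S : Finset ι => (1 / 2) ^ #S)
      ≤ c ^ w * (1 / 1024) ^ w := mul_le_mul_of_nonneg_left hmean (pow_nonneg hc.1 w)
    _ = (c / 1024) ^ w := by rw [← mul_pow, mul_one_div]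
    _ ≤ c / 1024 := pow_le_of_le_one (by linarith [hc.1]) (by linarith [hc.2])
        (Nat.one_le_iff_ne_zero.1 hw)

theorem pow_mul_bernoulliMean_pow_le (hw : 1 ≤ w) {v : ℝ} (hv : v ∈ Set.Icc 0 1)
    (hvn : v * Fintype.card ι ≤ w / 300) :
    (1 / 100) ^ w * bernoulliMean v (fun S : Finset ι => 300 ^ #S) ≤ 3 / 100 := by
  have hmean : bernoulliMean v (fun S : Finset ι => 300 ^ #S) ≤ 3 ^ w :=
    calc bernoulliMean v (fun S : Finset ι => 300 ^ #S)
        ≤ Real.exp (v * Fintype.card ι * (300 - 1)) :=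
          bernoulliMean_pow_card_le hv (by norm_num)
      _ ≤ Real.exp (w * 1) := Real.exp_le_exp.2 (by linarith [Nat.cast_nonneg (α := ℝ) w])
      _ = Real.exp 1 ^ w := Real.exp_nat_mul _ _
      _ ≤ 3 ^ w := pow_le_pow_left₀ (Real.exp_nonneg _) Real.exp_one_lt_three.le w
  calc (1 / 100) ^ w * bernoulliMean v (fun S : Finset ι => 300 ^ #S)
      ≤ (1 / 100) ^ w * 3 ^ w := mul_le_mul_of_nonneg_left hmean (by positivity)
    _ = (3 / 100) ^ w := by rw [← mul_pow]; norm_num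
    _ ≤ 3 / 100 := pow_le_of_le_one (by norm_num) (by norm_num) (Nat.one_le_iff_ne_zero.1 hw)

theorem abs_pairMean_le_of_abs_le_of_card_lt {f : Finset ι × Finset κ → ℝ} {c u v : ℝ}
    (hdw : d < w) (hf : f ∈ pairPoly ℝ ι κ d)
    (hc : ∀ A B, #B < w → #A < w ∨ 2 * w ≤ #A → |f (A, B)| ≤ c)
    (hu : u ∈ Set.Icc 0 1) (hv : v ∈ Set.Icc 0 1)
    (hun : 20 * w ≤ u * Fintype.card ι) (hvn : v * Fintype.card κ ≤ w / 300) :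
    |pairMean u v f| ≤ 6 / 5 * c := by
  have hw : 1 ≤ w := hdw.pos
  have hc0 : 0 ≤ c := (abs_nonneg _).trans (hc ∅ ∅ (by simpa) (by simp [hdw.pos]))
  let g (A : Finset ι) : ℝ := 1 + 36 ^ w * (1 / 2) ^ #A
  let h (B : Finset κ) : ℝ := 1 + (1 / 100) ^ w * 300 ^ #B
  have hg : bernoulliMean u g ≤ 1 + 36 / 1024 :=
    calc bernoulliMean u g = 1 + 36 ^ w * bernoulliMean u (fun A : Finset ι => (1 / 2) ^ #A) :=
          bernoulliMean_one_add_const_mul u _ _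
      _ ≤ 1 + 36 / 1024 := by
          gcongr
          exact pow_mul_bernoulliMean_half_pow_le hw hu hun (by norm_num)
  have hh : bernoulliMean v h ≤ 1 + 3 / 100 :=
    calc bernoulliMean v h = 1 + (1 / 100) ^ w * bernoulliMean v (fun B : Finset κ => 300 ^ #B) :=
          bernoulliMean_one_add_const_mul v _ _
      _ ≤ 1 + 3 / 100 := by
          gcongr
          exact pow_mul_bernoulliMean_pow_le hw hv hvn
  have hh0 : 0 ≤ bernoulliMean v h :=
    (map_zero (bernoulliMean v)).symm.trans_le
      (bernoulliMean_mono hv (a := 0) (b := h) fun B => by positivity)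
  calc |pairMean u v f| ≤ pairMean u v (c • fun S => g S.1 * h S.2) :=
        abs_pairMean_le hu hv fun S => abs_le_of_abs_le_of_card_lt hdw hf hc S.1 S.2
    _ = c * (bernoulliMean u g * bernoulliMean v h) := by
        rw [map_smul, pairMean_mul, smul_eq_mul]
    _ ≤ c * ((1 + 36 / 1024) * (1 + 3 / 100)) := by gcongr
    _ ≤ 6 / 5 * c := by linarith

theorem le_pairMean_of_le_of_le_card {f : Finset ι × Finset κ → ℝ} {c u v : ℝ} (hw : 1 ≤ w)
    (hf : ∀ S, 0 ≤ f S) (hc0 : 0 ≤ c) (hc : ∀ A B, 2 * w ≤ #A → 2 * w ≤ #B → c ≤ f (A, B))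
    (hu : u ∈ Set.Icc 0 1) (hv : v ∈ Set.Icc 0 1)
    (hun : 20 * w ≤ u * Fintype.card ι) (hvn : 20 * w ≤ v * Fintype.card κ) :
    9 / 10 * c ≤ pairMean u v f := by
  let g : Finset ι × Finset κ → ℝ :=
    1 - (4 ^ w : ℝ) • (fun S => (1 / 2) ^ #S.1) - (4 ^ w : ℝ) • fun S => (1 / 2) ^ #S.2
  have hA := pow_mul_bernoulliMean_half_pow_le hw hu hun (c := 4) (by norm_num)
  have hB := pow_mul_bernoulliMean_half_pow_le hw hv hvn (c := 4) (by norm_num)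
  calc 9 / 10 * c ≤ c * (1 - 4 / 1024 - 4 / 1024) := by linarith
    _ ≤ c * (1 - 4 ^ w * bernoulliMean u (fun A : Finset ι => (1 / 2) ^ #A) -
        4 ^ w * bernoulliMean v (fun B : Finset κ => (1 / 2) ^ #B)) := by gcongr
    _ = pairMean u v (c • g) := by
        simp only [g, map_smul, map_sub, pairMean_one, smul_eq_mul,
          pairMean_fst u v fun A : Finset ι => (1 / 2 : ℝ) ^ #A,
          pairMean_snd u v fun B : Finset κ => (1 / 2 : ℝ) ^ #B]
    _ ≤ pairMean u v f := pairMean_mono hu hv fun S =>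
        mul_one_sub_half_pow_le_of_le_card hf hc0 hc S.1 S.2

end MeanBounds

section DegreeBound

variable {ι : Type*} [Fintype ι] [DecidableEq ι] {w d : ℕ} {f : Finset ι × Finset ι → ℝ} {c : ℝ}

-- The mean sizes `20 w e ^ θ` and `20 w e ^ (-θ)` put the first set far above `2 w` and the second
-- far below `w`.
theorem abs_pairMean_exp_le {θ : ℝ} (hdw : d < w) (hf : f ∈ pairPoly ℝ ι ι d)
    (hc : ∀ A B, #B < w → #A < w ∨ 2 * w ≤ #A → |f (A, B)| ≤ c) (hθ : 0 ≤ θ)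
    (hcosh : Real.cosh θ ∈ Set.Icc 6000 (Fintype.card ι / (40 * w) : ℝ)) :
    |pairMean (20 * w / Fintype.card ι * Real.exp θ) (20 * w / Fintype.card ι * Real.exp (-θ)) f| ≤
      6 / 5 * c := by
  set n := (Fintype.card ι : ℝ)
  set x : ℝ := 20 * w / n
  have hw : (0 : ℝ) < w := Nat.cast_pos.2 hdw.pos
  have hn : 0 < n := by
    have := (le_div_iff₀ (by positivity)).1 (hcosh.1.trans hcosh.2)
    linarith
  have hx : 0 < x := by positivity
  have hxn : x * n = 20 * w := div_mul_cancel₀ _ hn.ne'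
  have hexp_ge : 6000 ≤ Real.exp θ := by
    linarith [hcosh.1, Real.cosh_add_sinh θ, Real.sinh_nonneg_iff.2 hθ]
  have hu : x * Real.exp θ ∈ Set.Icc 0 1 := by
    refine ⟨mul_nonneg hx.le (Real.exp_nonneg θ), ?_⟩
    calc x * Real.exp θ ≤ x * (2 * Real.cosh θ) := by
          gcongr
          linarith [Real.cosh_eq θ, Real.exp_nonneg (-θ)]
      _ ≤ x * (2 * (n / (40 * w))) := by gcongr; exact hcosh.2
      _ = 1 := by
        simp only [x]
        field_simp
        norm_num
  have hv : x * Real.exp (-θ) ∈ Set.Icc 0 1 :=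
    ⟨by positivity, le_trans (by gcongr; linarith) hu.2⟩
  refine abs_pairMean_le_of_abs_le_of_card_lt hdw hf hc hu hv ?_ ?_
  · calc (20 * w : ℝ) ≤ 20 * w * Real.exp θ := le_mul_of_one_le_right (by positivity) (by linarith)
      _ = x * Real.exp θ * n := by rw [← hxn]; ring
  · calc x * Real.exp (-θ) * n = 20 * w * (Real.exp θ)⁻¹ := by rw [Real.exp_neg, ← hxn]; ring
      _ ≤ 20 * w * 6000⁻¹ := by gcongr
      _ = w / 300 := by ring

theorem one_third_le_of_three_halves_le_exp {y : ℝ} (h : 3 / 2 ≤ Real.exp y) : 1 / 3 ≤ y :=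
  calc (1 / 3 : ℝ) = 1 - (3 / 2)⁻¹ := by norm_num
    _ ≤ Real.log (3 / 2) := Real.one_sub_inv_le_log_of_pos (by norm_num)
    _ ≤ y := (Real.log_le_iff_le_exp (by norm_num)).2 h

theorem exists_polynomial_of_separates (hdw : d < w) (hf : f ∈ pairPoly ℝ ι ι d)
    (hf0 : ∀ S, 0 ≤ f S) (hc0 : 0 ≤ c)
    (hno : ∀ A B, #B < w → #A < w ∨ 2 * w ≤ #A → f (A, B) ≤ c ∧ f (B, A) ≤ c)
    (hyes : ∀ A B, 2 * w ≤ #A → 2 * w ≤ #B → 2 * c ≤ f (A, B))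
    (hcard : (20 * w : ℝ) ≤ Fintype.card ι) :
    ∃ p : Polynomial ℝ, p.natDegree ≤ d ∧ 18 / 5 * c ≤ p.eval 1 ∧
      ∀ t ∈ Set.Icc 6000 (Fintype.card ι / (40 * w) : ℝ), |p.eval t| ≤ 12 / 5 * c := by
  set n := (Fintype.card ι : ℝ)
  obtain ⟨p, hpdeg, hp⟩ := exists_polynomial_eval_cosh_eq_pairMean hf (20 * w / n)
  set g := f + f ∘ Prod.swap
  have hg : g ∈ pairPoly ℝ ι ι d := add_mem hf (swap_mem_pairPoly hf)
  have hg0 (S : Finset ι × Finset ι) : 0 ≤ g S := add_nonneg (hf0 _) (hf0 _)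
  have hgno (A B : Finset ι) (hB : #B < w) (hA : #A < w ∨ 2 * w ≤ #A) : |g (A, B)| ≤ c + c := by
    rw [abs_of_nonneg (hg0 _)]
    exact add_le_add (hno A B hB hA).1 (hno A B hB hA).2
  have hgyes (A B : Finset ι) (hA : 2 * w ≤ #A) (hB : 2 * w ≤ #B) : 2 * c + 2 * c ≤ g (A, B) :=
    add_le_add (hyes A B hA hB) (hyes B A hB hA)
  refine ⟨p, hpdeg, ?_, fun t ht => ?_⟩
  · have hw : (0 : ℝ) < w := Nat.cast_pos.2 hdw.pos
    have hn : 0 < n := by linarith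
    have hmean : (20 * w : ℝ) ≤ 20 * w / n * n := (div_mul_cancel₀ _ hn.ne').ge
    have hx : 20 * w / n ∈ Set.Icc 0 1 := ⟨by positivity, (div_le_one hn).2 hcard⟩
    calc 18 / 5 * c = 9 / 10 * (2 * c + 2 * c) := by ring
      _ ≤ pairMean (20 * w / n) (20 * w / n) g :=
        le_pairMean_of_le_of_le_card hdw.pos hg0 (by linarith) hgyes hx hx hmean hmean
      _ = p.eval 1 := by simpa using (hp 0).symm
  · have hcosh : Real.cosh (Real.arcosh t) = t := Real.cosh_arcosh (by linarith [ht.1])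
    calc |p.eval t| ≤ 6 / 5 * (c + c) := by
          rw [← hcosh, hp]
          exact abs_pairMean_exp_le hdw hg hgno (Real.arcosh_nonneg (by linarith [ht.1]))
            (by rwa [hcosh])
      _ = 12 / 5 * c := by ring

theorem card_le_of_separates (hdw : d < w) (hf : f ∈ pairPoly ℝ ι ι d) (hf0 : ∀ S, 0 ≤ f S)
    (hc0 : 0 < c) (hno : ∀ A B, #B < w → #A < w ∨ 2 * w ≤ #A → f (A, B) ≤ c ∧ f (B, A) ≤ c)
    (hyes : ∀ A B, 2 * w ≤ #A → 2 * w ≤ #B → 2 * c ≤ f (A, B)) :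
    (Fintype.card ι : ℝ) ≤ 1440000 * (1 + d ^ 2) * w := by
  have hw : (0 : ℝ) < w := Nat.cast_pos.2 hdw.pos
  set m := (Fintype.card ι / (40 * w) : ℝ)
  have hmw : (Fintype.card ι : ℝ) = m * (40 * w) := (div_mul_cancel₀ _ (by positivity)).symm
  suffices h : m ≤ 36000 * (1 + d ^ 2) by
    rw [hmw]
    linarith [mul_le_mul_of_nonneg_right h hw.le]
  by_cases hlong : m ≤ 6000
  · linarith [sq_nonneg (d : ℝ)]
  rw [not_le] at hlong
  have hcard : (20 * w : ℝ) ≤ Fintype.card ι := by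
    rw [hmw]
    nlinarith
  obtain ⟨p, hpdeg, hlarge, hsmall⟩ :=
    exists_polynomial_of_separates hdw hf hf0 hc0.le hno hyes hcard
  have hgrowth := hlarge.trans
    (eval_le_mul_exp_of_abs_le hpdeg hlong (by positivity) (by norm_num) hsmall)
  have hexponent : 1 / 3 ≤ (d ^ 2 * (2 * (6000 - 1) / (m - 6000)) : ℝ) :=
    one_third_le_of_three_halves_le_exp <| le_of_mul_le_mul_left (by linarith) hc0
  rw [← mul_div_assoc, le_div_iff₀ (sub_pos.2 hlong)] at hexponent
  linarith [sq_nonneg (d : ℝ)]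

end DegreeBound

section ApxCountBound

variable {N w : ℕ} {Q : QueryAlgorithm N}

theorem one_le_numQueries (hw : 1 ≤ w) (hN : 2 * w ≤ N) (hQ : Q.IsSBQP (AND₂ (ApxCount N w))) :
    1 ≤ Q.numQueries := by
  obtain ⟨α, hα, hyes, hno⟩ := hQ
  by_contra! hT
  have hdeg := acceptProb_mem_pairPoly Q
  rw [Nat.lt_one_iff.1 hT, mul_zero] at hdeg
  let a : Fin N := ⟨0, by omega⟩
  have hlarge : (univ : Finset (Fin N)) ∈ (ApxCount N w).yes := ⟨⟨a, mem_univ a⟩, by simpa using hN⟩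
  have hsmall : ({a} : Finset (Fin N)) ∈ (ApxCount N w).no :=
    ⟨singleton_nonempty a, by simpa using hw⟩
  have hle : 2 * α ≤ α :=
    calc 2 * α ≤ Q.acceptProb (univ, univ) := hyes _ ⟨hlarge, hlarge⟩
      _ = Q.acceptProb ({a}, {a}) := apply_eq_apply_of_mem_pairPoly_zero hdeg _ _
      _ ≤ α := hno _ ⟨⟨.inr hsmall, .inr hsmall⟩, .inl hsmall⟩
  linarith

theorem le_of_two_mul_numQueries_lt (hQ : Q.IsSBQP (AND₂ (ApxCount N w)))
    (hT : 2 * Q.numQueries < w) : (N : ℝ) ≤ 1440000 * (1 + (2 * Q.numQueries) ^ 2) * w := by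
  obtain ⟨α, hα, hyes, hno⟩ := hQ
  -- Instances are nonempty, so both sets are enlarged by a fixed element `a`; this keeps large
  -- sets large, and sets of fewer than `w` elements small.
  let a : Fin N := Q.start.1.2.1
  have hlarge {A : Finset (Fin N)} (hA : 2 * w ≤ #A) : insert a A ∈ (ApxCount N w).yes :=
    ⟨insert_nonempty a A, hA.trans (card_le_card (subset_insert a A))⟩
  have hsmall {A : Finset (Fin N)} (hA : #A < w) : insert a A ∈ (ApxCount N w).no :=
    ⟨insert_nonempty a A, (card_insert_le a A).trans hA⟩
  have h := card_le_of_separates hT (insert_mem_pairPoly (acceptProb_mem_pairPoly Q) a a)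
    (fun S => acceptProb_nonneg Q _) hα (fun A B hB hA => ?_)
    (fun A B hA hB => hyes _ ⟨hlarge hA, hlarge hB⟩)
  · simpa using h
  · have hpromise := hA.symm.imp (hlarge (A := A)) hsmall
    exact ⟨hno _ ⟨⟨hpromise, .inr (hsmall hB)⟩, .inr (hsmall hB)⟩,
      hno _ ⟨⟨.inr (hsmall hB), hpromise⟩, .inl (hsmall hB)⟩⟩

end ApxCountBound

end SBQPQuery

theorem theorem1p2 :
    ∃ c : ℝ, 0 < c ∧ ∀ N w : ℕ, 1 ≤ w → 2 * w ≤ N →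
      ∀ Q : SBQPQuery.QueryAlgorithm N,
        Q.IsSBQP (SBQPQuery.AND₂ (SBQPQuery.ApxCount N w)) →
          c * min (w : ℝ) (Real.sqrt ((N : ℝ) / (w : ℝ))) ≤ (Q.numQueries : ℝ) := by
  refine ⟨1 / 3000, by norm_num, fun N w hw hN Q hQ => ?_⟩
  have hT : (1 : ℝ) ≤ Q.numQueries := by exact_mod_cast SBQPQuery.one_le_numQueries hw hN hQ
  suffices h : min (w : ℝ) √(N / w) ≤ 3000 * Q.numQueries by linarith
  rcases le_or_gt w (2 * Q.numQueries) with hwT | hTw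
  · have hwT' : (w : ℝ) ≤ 2 * Q.numQueries := by exact_mod_cast hwT
    exact (min_le_left _ _).trans (by linarith)
  · refine (min_le_right _ _).trans (Real.sqrt_le_iff.2 ⟨by positivity, ?_⟩)
    calc (N / w : ℝ) ≤ 1440000 * (1 + (2 * Q.numQueries) ^ 2) :=
          (div_le_iff₀ (Nat.cast_pos.2 hw)).2 (SBQPQuery.le_of_two_mul_numQueries_lt hQ hTw)
      _ ≤ (3000 * Q.numQueries) ^ 2 := by nlinarith
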